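/- Let $\mathbb F$ be a field of characteristic zero. Let $O$ be the Onsager Lie algebra over $\mathbb F$, that is, the Lie algebra with generators $A,B$ and relations $[A,[A,[A,B]]]=4[A,B]$ and $[B,[B,[B,A]]]=4[B,A]$. Let $\mathfrak{sl}_2$ have its usual basis $e,f,h$ and put $x=2e-h$, $y=-2f-h$, $z=h$. Let $\mathcal A=\mathbb F[t,t^{-1},(t-1)^{-1}]$, and let $L(\mathfrak{sl}_2)^+=\mathfrak{sl}_2\otimes\mathcal A$ with bracket $[u\otimes a,v\otimes b]=[u,v]\otimes ab$, regarded as an $\mathcal A$-module by $(u\otimes a)b=u\otimes ab$. The Lie algebra homomorphism $O\to L(\mathfrak{sl}_2)^+$ that sends $A\mapsto x\otimes 1$ and $B\mapsto y\otimes t+z\otimes(t-1)$ is injective; identify $O$ with its image. Then each of the following four families $\{A_i\}_{i\ge0}\cup\{B_i\}_{i\ge0}\cup\{\psi_i\}_{i\ge1}$ is a basis of the vector space $O$: - $[0312]$: $A_i=x\otimes(t-1)^i$, $B_i=(y\otimes t+z\otimes(t-1))(t-1)^i$, $\psi_i=z\otimes(t-1)^i$; - $[3021]$: $A_i=-x\otimes(t-1)^i$,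 $B_i=(-y\otimes t-z\otimes(t-1))(t-1)^i$, $\psi_i=(-x\otimes1-y\otimes t)(t-1)^{i-1}$; - $[0321]$: $A_i=-x\otimes(-t)^i$, $B_i=(y\otimes t+z\otimes(t-1))(-t)^i$, $\psi_i=-y\otimes(-t)^i$; - $[3012]$: $A_i=x\otimes(-t)^i$, $B_i=(-y\otimes t-z\otimes(t-1))(-t)^i$, $\psi_i=(x\otimes1-z\otimes(t-1))(-t)^{i-1}$. Moreover, each of these bases is obtained recursively, in the order $A_0,B_0,\psi_1,A_1,B_1,\psi_2,A_2,B_2,\psi_3,\dots$, from the following initial values and equations for $i\ge1$; that is, it satisfies them, and it is the only family of elements of $O$ that does: - $[0312]$: $A_0=A$, $B_0=B$, and $$\psi_i=\frac{A_{i-1}}2+\frac{B_{i-1}}2-\frac{[A_{i-1},B]}4,\qquad A_i=\frac{[\psi_i,A]}2-\psi_i,\qquad B_i=\frac{[B,\psi_i]}2-\psi_i;$$ - $[3021]$: $A_0=-A$, $B_0=-B$, and $$\psi_i=\frac{A_{i-1}}2+\frac{B_{i-1}}2+\frac{[A_{i-1},B]}4,\qquad A_i=-\frac{[\psi_i,A]}2-\psi_i,\qquad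 B_i=-\frac{[B,\psi_i]}2-\psi_i;$$ - $[0321]$: $A_0=-A$, $B_0=B$, and $$\psi_i=\frac{A_{i-1}}2+\frac{B_{i-1}}2-\frac{[A_{i-1},B]}4,\qquad A_i=-\frac{[\psi_i,A]}2-\psi_i,\qquad B_i=\frac{[B,\psi_i]}2-\psi_i;$$ - $[3012]$: $A_0=A$, $B_0=-B$, and $$\psi_i=\frac{A_{i-1}}2+\frac{B_{i-1}}2+\frac{[A_{i-1},B]}4,\qquad A_i=\frac{[\psi_i,A]}2-\psi_i,\qquad B_i=-\frac{[B,\psi_i]}2-\psi_i.$$ -/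

import Mathlib

open scoped TensorProduct Polynomial

namespace Onsager

noncomputable section

/-! ### The Onsager Lie algebra, by generators and relations -/

/-- Symbols for the two standard generators. -/
inductive Gen where
  | A : Gen
  | B : Gen

/-- The two Dolan-Grady elements, `[A,[A,[A,B]]] - 4[A,B]` and `[B,[B,[B,A]]] - 4[B,A]`, of the
free Lie algebra on `A`, `B`. -/
def dolanGrady (F : Type*) [Field F] : Set (FreeLieAlgebra F Gen) :=
  let a := FreeLieAlgebra.of F Gen.A
  let b := FreeLieAlgebra.of F Gen.B
  {⁅a, ⁅a, ⁅a, b⁆⁆⁆ - (4 : F) • ⁅a, b⁆, ⁅b, ⁅b, ⁅b, a⁆⁆⁆ - (4 : F) • ⁅b, a⁆}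

/-- The Lie ideal generated by the Dolan-Grady elements. -/
def dolanGradyIdeal (F : Type*) [Field F] : LieIdeal F (FreeLieAlgebra F Gen) :=
  LieSubmodule.lieSpan F _ (dolanGrady F)

/-- The Onsager Lie algebra `O` over `F`: generators `A`, `B` and the Dolan-Grady relations. -/
abbrev O (F : Type*) [Field F] : Type _ := FreeLieAlgebra F Gen ⧸ dolanGradyIdeal F

/-- The standard generator `A` of `O`. -/
def genA (F : Type*) [Field F] : O F :=
  LieSubmodule.Quotient.mk' (dolanGradyIdeal F) (FreeLieAlgebra.of F Gen.A)

/-- The standard generator `B` of `O`. -/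
def genB (F : Type*) [Field F] : O F :=
  LieSubmodule.Quotient.mk' (dolanGradyIdeal F) (FreeLieAlgebra.of F Gen.B)

/-! ### The three-point `sl₂` loop algebra -/

/-- The Lie algebra `sl₂` of traceless `2 × 2` matrices. -/
abbrev Sl2 (F : Type*) [Field F] : Type _ := LieAlgebra.SpecialLinear.sl (Fin 2) F

/-- The usual basis element `e` of `sl₂`. -/
def sl2E (F : Type*) [Field F] : Sl2 F := LieAlgebra.SpecialLinear.single 0 1 (by decide) 1

/-- The usual basis element `f` of `sl₂`. -/
def sl2F (F : Type*) [Field F] : Sl2 F := LieAlgebra.SpecialLinear.single 1 0 (by decide) 1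

/-- The usual basis element `h` of `sl₂`. -/
def sl2H (F : Type*) [Field F] : Sl2 F := LieAlgebra.SpecialLinear.singleSubSingle 0 1 1

/-- The element `x = 2e - h` of the equitable basis. -/
def eqX (F : Type*) [Field F] : Sl2 F := (2 : F) • sl2E F - sl2H F

/-- The element `y = -2f - h` of the equitable basis. -/
def eqY (F : Type*) [Field F] : Sl2 F := -((2 : F) • sl2F F) - sl2H F

/-- The element `z = h` of the equitable basis. -/
def eqZ (F : Type*) [Field F] : Sl2 F := sl2H F

/-- The algebra `𝒜 = F[t, t⁻¹, (t-1)⁻¹]`. -/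
abbrev Laurent (F : Type*) [Field F] : Type _ :=
  Localization.Away (Polynomial.X * (Polynomial.X - 1) : F[X])

/-- The indeterminate `t`, as an element of `𝒜`. -/
def tvar (F : Type*) [Field F] : Laurent F := algebraMap F[X] (Laurent F) Polynomial.X

/-- The three-point loop algebra `L(sl₂)⁺`: the tensor product of `sl₂` and `𝒜`, with bracket
`[u ⊗ a, v ⊗ b] = [u, v] ⊗ ab`. The factor `𝒜` is written on the left, so that `u ⊗ a` reads
`a ⊗ₜ u`, and the action of `𝒜` reads `b • (a ⊗ₜ u) = (b * a) ⊗ₜ u`. -/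
abbrev Loop (F : Type*) [Field F] : Type _ := Laurent F ⊗[F] Sl2 F

/-- `x ⊗ 1`. -/
def loopA (F : Type*) [Field F] : Loop F := 1 ⊗ₜ[F] eqX F

/-- `y ⊗ t + z ⊗ (t - 1)`. -/
def loopB (F : Type*) [Field F] : Loop F := tvar F ⊗ₜ[F] eqY F + (tvar F - 1) ⊗ₜ[F] eqZ F

/-! ### The homomorphism from `O` to the loop algebra -/

section

attribute [local instance 100] LieRing.ofAssociativeRing

theorem lie_eqX_eqY (F : Type*) [Field F] :
    ⁅eqX F, eqY F⁆ = (2 : F) • eqX F + (2 : F) • eqY F := by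
  apply Subtype.ext
  rw [LieAlgebra.SpecialLinear.sl_bracket]
  ext i j
  fin_cases i <;> fin_cases j <;>
    simp [eqX, eqY, sl2E, sl2F, sl2H, Matrix.mul_apply, Fin.sum_univ_two, Matrix.single] <;>
    ring

theorem lie_eqZ_eqX (F : Type*) [Field F] :
    ⁅eqZ F, eqX F⁆ = (2 : F) • eqZ F + (2 : F) • eqX F := by
  apply Subtype.ext
  rw [LieAlgebra.SpecialLinear.sl_bracket]
  ext i j
  fin_cases i <;> fin_cases j <;>
    simp [eqX, eqZ, sl2E, sl2H, Matrix.mul_apply, Matrix.single]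
  ring

theorem lie_eqY_eqZ (F : Type*) [Field F] :
    ⁅eqY F, eqZ F⁆ = (2 : F) • eqY F + (2 : F) • eqZ F := by
  apply Subtype.ext
  rw [LieAlgebra.SpecialLinear.sl_bracket]
  ext i j
  fin_cases i <;> fin_cases j <;>
    simp [eqY, eqZ, sl2F, sl2H, Matrix.mul_apply, Matrix.single]
  ring

end

/-- The Dolan-Grady relations for `x` and `s y + (s - 1) z`, for an equitable triple `x, y, z`. -/
theorem dolanGrady_aux {L R : Type*} [CommRing R] [LieRing L] [LieAlgebra R L] (X Y Z : L) (s : R)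
    (hXY : ⁅X, Y⁆ = (2 : R) • X + (2 : R) • Y) (hYZ : ⁅Y, Z⁆ = (2 : R) • Y + (2 : R) • Z)
    (hZX : ⁅Z, X⁆ = (2 : R) • Z + (2 : R) • X) :
    ⁅X, ⁅X, ⁅X, s • Y + (s - 1) • Z⁆⁆⁆ = (4 : R) • ⁅X, s • Y + (s - 1) • Z⁆ ∧
    ⁅s • Y + (s - 1) • Z, ⁅s • Y + (s - 1) • Z, ⁅s • Y + (s - 1) • Z, X⁆⁆⁆ =
      (4 : R) • ⁅s • Y + (s - 1) • Z, X⁆ := by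
  have hYX : ⁅Y, X⁆ = -((2 : R) • X + (2 : R) • Y) := by rw [← lie_skew, hXY]
  have hZY : ⁅Z, Y⁆ = -((2 : R) • Y + (2 : R) • Z) := by rw [← lie_skew, hYZ]
  have hXZ : ⁅X, Z⁆ = -((2 : R) • Z + (2 : R) • X) := by rw [← lie_skew, hZX]
  constructor <;>
  · simp only [lie_add, add_lie, lie_smul, smul_lie, lie_neg, lie_self, lie_zero,
      hXY, hYZ, hZX, hYX, hZY, hXZ]
    module

theorem loop_dolanGrady (F : Type*) [Field F] :
    ⁅loopA F, ⁅loopA F, ⁅loopA F, loopB F⁆⁆⁆ = (4 : F) • ⁅loopA F, loopB F⁆ ∧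
    ⁅loopB F, ⁅loopB F, ⁅loopB F, loopA F⁆⁆⁆ = (4 : F) • ⁅loopB F, loopA F⁆ := by
  have key := dolanGrady_aux (R := Laurent F) (L := Loop F) (1 ⊗ₜ[F] eqX F) (1 ⊗ₜ[F] eqY F)
    (1 ⊗ₜ[F] eqZ F) (tvar F)
    (by
      rw [LieAlgebra.ExtendScalars.bracket_tmul, lie_eqX_eqY, TensorProduct.tmul_add,
        TensorProduct.tmul_smul, TensorProduct.tmul_smul, one_mul]
      simp only [ofNat_smul_eq_nsmul])
    (by
      rw [LieAlgebra.ExtendScalars.bracket_tmul, lie_eqY_eqZ, TensorProduct.tmul_add,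
        TensorProduct.tmul_smul, TensorProduct.tmul_smul, one_mul]
      simp only [ofNat_smul_eq_nsmul])
    (by
      rw [LieAlgebra.ExtendScalars.bracket_tmul, lie_eqZ_eqX, TensorProduct.tmul_add,
        TensorProduct.tmul_smul, TensorProduct.tmul_smul, one_mul]
      simp only [ofNat_smul_eq_nsmul])
  have hB : tvar F • (1 ⊗ₜ[F] eqY F : Loop F) + (tvar F - 1) • (1 ⊗ₜ[F] eqZ F : Loop F)
      = loopB F := by
    simp [loopB, TensorProduct.smul_tmul']
  rw [hB] at key
  simpa only [loopA, ofNat_smul_eq_nsmul] using key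

/-- The Lie algebra homomorphism `O → L(sl₂)⁺` that sends `A` to `x ⊗ 1` and `B` to
`y ⊗ t + z ⊗ (t - 1)`. -/
def toLoop (F : Type*) [Field F] : O F →ₗ⁅F⁆ Loop F :=
  let φ : FreeLieAlgebra F Gen →ₗ⁅F⁆ Loop F :=
    FreeLieAlgebra.lift F fun
      | Gen.A => loopA F
      | Gen.B => loopB F
  have hφ : dolanGradyIdeal F ≤ φ.ker := by
    rw [dolanGradyIdeal, LieSubmodule.lieSpan_le]
    rintro w (rfl | rfl)
    · simp [φ, LieHom.mem_ker, (loop_dolanGrady F).1]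
    · simp [φ, LieHom.mem_ker, (loop_dolanGrady F).2]
  { (dolanGradyIdeal F).toSubmodule.liftQ (φ : FreeLieAlgebra F Gen →ₗ[F] Loop F) hφ with
    map_lie' := by
      rintro ⟨u⟩ ⟨v⟩
      exact φ.map_lie u v }

theorem toLoop_genA (F : Type*) [Field F] : toLoop F (genA F) = loopA F :=
  FreeLieAlgebra.lift_of_apply (R := F) _ Gen.A

theorem toLoop_genB (F : Type*) [Field F] : toLoop F (genB F) = loopB F :=
  FreeLieAlgebra.lift_of_apply (R := F) _ Gen.B

/-! ### The four bases, inside the loop algebra -/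

/-- `A↑↑_i = x ⊗ (t-1)^i`. -/
def aUU (F : Type*) [Field F] (i : ℕ) : Loop F := ((tvar F - 1) ^ i) ⊗ₜ[F] eqX F

/-- `B↑↑_i = (y ⊗ t + z ⊗ (t-1)) (t-1)^i`. -/
def bUU (F : Type*) [Field F] (i : ℕ) : Loop F :=
  (tvar F - 1) ^ i • (tvar F ⊗ₜ[F] eqY F + (tvar F - 1) ⊗ₜ[F] eqZ F)

/-- `ψ↑↑_{i+1} = z ⊗ (t-1)^{i+1}`. -/
def psiUU (F : Type*) [Field F] (i : ℕ) : Loop F := ((tvar F - 1) ^ (i + 1)) ⊗ₜ[F] eqZ F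

/-- `A↓↓_i = -x ⊗ (t-1)^i`. -/
def aDD (F : Type*) [Field F] (i : ℕ) : Loop F := -(((tvar F - 1) ^ i) ⊗ₜ[F] eqX F)

/-- `B↓↓_i = (-y ⊗ t - z ⊗ (t-1)) (t-1)^i`. -/
def bDD (F : Type*) [Field F] (i : ℕ) : Loop F :=
  (tvar F - 1) ^ i • (-(tvar F ⊗ₜ[F] eqY F) - (tvar F - 1) ⊗ₜ[F] eqZ F)

/-- `ψ↓↓_{i+1} = (-x ⊗ 1 - y ⊗ t) (t-1)^i`. -/
def psiDD (F : Type*) [Field F] (i : ℕ) : Loop F :=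
  (tvar F - 1) ^ i • (-(1 ⊗ₜ[F] eqX F) - tvar F ⊗ₜ[F] eqY F)

/-- `A↓↑_i = -x ⊗ (-t)^i`. -/
def aDU (F : Type*) [Field F] (i : ℕ) : Loop F := -(((-tvar F) ^ i) ⊗ₜ[F] eqX F)

/-- `B↓↑_i = (y ⊗ t + z ⊗ (t-1)) (-t)^i`. -/
def bDU (F : Type*) [Field F] (i : ℕ) : Loop F :=
  (-tvar F) ^ i • (tvar F ⊗ₜ[F] eqY F + (tvar F - 1) ⊗ₜ[F] eqZ F)

/-- `ψ↓↑_{i+1} = -y ⊗ (-t)^{i+1}`. -/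
def psiDU (F : Type*) [Field F] (i : ℕ) : Loop F := -(((-tvar F) ^ (i + 1)) ⊗ₜ[F] eqY F)

/-- `A↑↓_i = x ⊗ (-t)^i`. -/
def aUD (F : Type*) [Field F] (i : ℕ) : Loop F := ((-tvar F) ^ i) ⊗ₜ[F] eqX F

/-- `B↑↓_i = (-y ⊗ t - z ⊗ (t-1)) (-t)^i`. -/
def bUD (F : Type*) [Field F] (i : ℕ) : Loop F :=
  (-tvar F) ^ i • (-(tvar F ⊗ₜ[F] eqY F) - (tvar F - 1) ⊗ₜ[F] eqZ F)

/-- `ψ↑↓_{i+1} = (x ⊗ 1 - z ⊗ (t-1)) (-t)^i`. -/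
def psiUD (F : Type*) [Field F] (i : ℕ) : Loop F :=
  (-tvar F) ^ i • (1 ⊗ₜ[F] eqX F - (tvar F - 1) ⊗ₜ[F] eqZ F)

/-! ### The four recursions, inside `O` -/

/-- Elements `A_0, B_0, ψ_1, A_1, B_1, ψ_2, …` of `O` are indexed by their type and number:
`Idx.A i` stands for `A_i`, `Idx.B i` for `B_i`, and `Idx.psi i` for `ψ_{i+1}`. -/
inductive Idx where
  | A : ℕ → Idx
  | B : ℕ → Idx
  | psi : ℕ → Idx

open Idx

/-- The recursion for `[0312]`. -/
def Rec0312 (F : Type*) [Field F] (v : Idx → O F) : Prop :=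
  v (A 0) = genA F ∧ v (B 0) = genB F ∧ ∀ i : ℕ,
    v (psi i) = (1 / 2 : F) • v (A i) + (1 / 2 : F) • v (B i) - (1 / 4 : F) • ⁅v (A i), genB F⁆ ∧
    v (A (i + 1)) = (1 / 2 : F) • ⁅v (psi i), genA F⁆ - v (psi i) ∧
    v (B (i + 1)) = (1 / 2 : F) • ⁅genB F, v (psi i)⁆ - v (psi i)

/-- The recursion for `[3021]`. -/
def Rec3021 (F : Type*) [Field F] (v : Idx → O F) : Prop :=
  v (A 0) = -genA F ∧ v (B 0) = -genB F ∧ ∀ i : ℕ,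
    v (psi i) = (1 / 2 : F) • v (A i) + (1 / 2 : F) • v (B i) + (1 / 4 : F) • ⁅v (A i), genB F⁆ ∧
    v (A (i + 1)) = -((1 / 2 : F) • ⁅v (psi i), genA F⁆) - v (psi i) ∧
    v (B (i + 1)) = -((1 / 2 : F) • ⁅genB F, v (psi i)⁆) - v (psi i)

/-- The recursion for `[0321]`. -/
def Rec0321 (F : Type*) [Field F] (v : Idx → O F) : Prop :=
  v (A 0) = -genA F ∧ v (B 0) = genB F ∧ ∀ i : ℕ,
    v (psi i) = (1 / 2 : F) • v (A i) + (1 / 2 : F) • v (B i) - (1 / 4 : F) • ⁅v (A i), genB F⁆ ∧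
    v (A (i + 1)) = -((1 / 2 : F) • ⁅v (psi i), genA F⁆) - v (psi i) ∧
    v (B (i + 1)) = (1 / 2 : F) • ⁅genB F, v (psi i)⁆ - v (psi i)

/-- The recursion for `[3012]`. -/
def Rec3012 (F : Type*) [Field F] (v : Idx → O F) : Prop :=
  v (A 0) = genA F ∧ v (B 0) = -genB F ∧ ∀ i : ℕ,
    v (psi i) = (1 / 2 : F) • v (A i) + (1 / 2 : F) • v (B i) + (1 / 4 : F) • ⁅v (A i), genB F⁆ ∧
    v (A (i + 1)) = (1 / 2 : F) • ⁅v (psi i), genA F⁆ - v (psi i) ∧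
    v (B (i + 1)) = -((1 / 2 : F) • ⁅genB F, v (psi i)⁆) - v (psi i)

end

end Onsager

/-! `O` is given only by generators and relations, so spanning is proved inside the Lie algebra and
independence is read off in the loop algebra. The four recursions are one recursion,
`IsRecSolution`, for the four pairs `(±A, ±B)`, and each of these pairs satisfies the Dolan-Grady
relations and generates `O`.

Spanning: a Dolan-Grady pair `a`, `b` extends to a two-sided sequence with `A 0 = 2a`, `A 1 = 2b`
and the brackets of Onsager's presentation (`IsDolanGradyPair.exists_isOnsagerSeq`). Iterating a
fixed Laurent polynomial in the shift yields a solution of the recursion whose brackets with `a` and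
`b` stay in its span. If `a` and `b` generate, the span is everything (`IsRecSolution.span_eq_top`).

Independence: the bracket of the loop algebra is linear over the Laurent ring, so the families `u ^
i • a`, `u ^ i • b`, `u ^ i • p` solve the recursion as soon as three bracket identities hold
(`IsPowerTriple`). A recursion has one solution, so this family is the image of the spanning
solution in `O`. It is linearly independent; hence the solution is a basis and `toLoop` is injective
(`exists_basis_of_powerFamily`). -/

namespace Onsager

/-! ### The propagation step behind Onsager's relations -/

section DolanGrady

variable {F L : Type*} [Field F] [LieRing L] [LieAlgebra F L]

/-- Here `pᵢ` stands for `A i` and `qᵢ` for `A (-i)`. The Jacobi identity forces `w = [p₂, p₀]` to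
commute with `g`; comparing the resulting relations then determines the next consecutive bracket. -/
theorem lie_consecutive_step [CharZero F] {g p₃ p₂ p₁ p₀ q₁ q₂ q₃ : L}
    (h₂ : ⁅g, p₂⁆ = (2 : F) • (p₃ - p₁)) (h₁ : ⁅g, p₁⁆ = (2 : F) • (p₂ - p₀))
    (h₀ : ⁅g, p₀⁆ = (2 : F) • (p₁ - q₁)) (k₁ : ⁅g, q₁⁆ = (2 : F) • (p₀ - q₂))
    (k₂ : ⁅g, q₂⁆ = (2 : F) • (q₁ - q₃))
    (c₂ : ⁅p₂, p₁⁆ = (4 : F) • g) (c₁ : ⁅p₁, p₀⁆ = (4 : F) • g) (c₀ : ⁅p₀, q₁⁆ = (4 : F) • g) :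
    ⁅q₁, q₂⁆ = (4 : F) • g := by
  have half : ∀ {u v : L}, (2 : F) • u = (2 : F) • v → u = v := fun h =>
    smul_right_injective L (two_ne_zero (α := F)) h
  have e₁ : ⁅p₂, p₀⁆ = ⁅p₁, q₁⁆ := by
    have := leibniz_lie g p₁ p₀
    rw [c₁, h₁, h₀] at this
    simp only [lie_smul, smul_lie, lie_self, lie_sub, sub_lie] at this
    apply half
    linear_combination (norm := module) -this
  have e₂ : ⁅p₁, q₁⁆ = ⁅p₀, q₂⁆ := by
    have := leibniz_lie g p₀ q₁
    rw [c₀, h₀, k₁] at this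
    simp only [lie_smul, smul_lie, lie_self, lie_sub, sub_lie] at this
    apply half
    linear_combination (norm := module) -this
  have c₂' : ⁅p₁, p₂⁆ = -((4 : F) • g) := by rw [← lie_skew, c₂]
  have c₁' : ⁅p₀, p₁⁆ = -((4 : F) • g) := by rw [← lie_skew, c₁]
  have c₀' : ⁅q₁, p₀⁆ = -((4 : F) • g) := by rw [← lie_skew, c₀]
  have s₁ : ⁅p₂, g⁆ = -((2 : F) • (p₃ - p₁)) := by rw [← lie_skew, h₂]
  have s₂ : ⁅p₁, g⁆ = -((2 : F) • (p₂ - p₀)) := by rw [← lie_skew, h₁]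
  have s₃ : ⁅p₀, g⁆ = -((2 : F) • (p₁ - q₁)) := by rw [← lie_skew, h₀]
  -- the element `w` is four times the next one, `G₂`
  set w := ⁅p₂, p₀⁆ with hw
  have w₀ : ⁅p₀, w⁆ = -((8 : F) • (p₂ - q₂)) := by
    rw [e₁, leibniz_lie, c₁', c₀]
    simp only [lie_smul, smul_lie, neg_lie, s₂, k₁]
    module
  have w₁ : ⁅p₁, w⁆ = -((8 : F) • (p₃ - q₁)) := by
    rw [hw, leibniz_lie, c₂', c₁]
    simp only [lie_smul, smul_lie, neg_lie, s₁, h₀]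
    module
  -- `[g, w]` is expanded from each of the three expressions of `w`; the third brings in the unknown
  -- `[q₁, q₂]`.
  have d₁ : ⁅g, w⁆ = (2 : F) • (⁅p₃, p₀⁆ - ⁅p₂, q₁⁆) := by
    rw [hw, leibniz_lie, h₂, h₀]
    simp only [lie_smul, smul_lie, lie_sub, sub_lie, c₂, c₁]
    module
  have d₂ : ⁅g, w⁆ = (2 : F) • (⁅p₂, q₁⁆ - ⁅p₁, q₂⁆) := by
    rw [e₁, leibniz_lie, h₁, k₁]
    simp only [lie_smul, smul_lie, lie_sub, sub_lie, c₁, c₀]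
    module
  have d₃ : ⁅g, w⁆ = (2 : F) • (⁅p₁, q₂⁆ - ⁅q₁, q₂⁆ + (4 : F) • g - ⁅p₀, q₃⁆) := by
    rw [e₁, e₂, leibniz_lie, h₀, k₂]
    simp only [lie_smul, smul_lie, lie_sub, sub_lie, c₀]
    module
  -- A fourth expansion, from `4g = [p₁, p₀]`. Against `d₁` and `d₂` it gives `12[g, w] = 0`.
  have d₄ : (4 : F) • ⁅g, w⁆ = -((8 : F) • (⁅p₃, p₀⁆ - ⁅p₁, q₂⁆)) := by
    have t : ⁅⁅p₁, p₀⁆, w⁆ = ⁅p₁, ⁅p₀, w⁆⁆ - ⁅p₀, ⁅p₁, w⁆⁆ := lie_lie _ _ _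
    rw [c₁, w₀, w₁] at t
    have t3 : ⁅p₀, p₃⁆ = -⁅p₃, p₀⁆ := (lie_skew _ _).symm
    simp only [lie_smul, smul_lie, lie_sub, lie_neg, c₂', c₀, t3] at t
    rw [t]; module
  have dz : ⁅g, w⁆ = 0 := by
    have : (12 : F) • ⁅g, w⁆ = 0 := by
      linear_combination (norm := module) (4 : F) • d₁ + (4 : F) • d₂ + d₄
    exact (smul_eq_zero.1 this).resolve_left (by norm_num)
  have w₂ : ⁅w, q₁⁆ = (8 : F) • (p₁ - q₃) := by
    have t : ⁅w, ⁅g, p₀⁆⁆ = ⁅g, ⁅w, p₀⁆⁆ := by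
      rw [leibniz_lie, ← lie_skew w g, dz]; simp
    have w₀' : ⁅w, p₀⁆ = (8 : F) • (p₂ - q₂) := by rw [← lie_skew, w₀, neg_neg]
    have w₁' : ⁅w, p₁⁆ = (8 : F) • (p₃ - q₁) := by rw [← lie_skew, w₁, neg_neg]
    rw [h₀, w₀'] at t
    simp only [lie_smul, lie_sub, h₂, k₂, w₁'] at t
    apply half
    linear_combination (norm := module) -t
  have f : ⁅q₁, q₂⁆ - (4 : F) • g = ⁅q₁, p₂⁆ + ⁅p₀, q₃⁆ := by
    have t : ⁅w, ⁅q₁, p₀⁆⁆ = ⁅⁅w, q₁⁆, p₀⁆ + ⁅q₁, ⁅w, p₀⁆⁆ := leibniz_lie _ _ _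
    have w₀' : ⁅w, p₀⁆ = (8 : F) • (p₂ - q₂) := by rw [← lie_skew, w₀, neg_neg]
    have z : ⁅w, g⁆ = 0 := by rw [← lie_skew, dz, neg_zero]
    have t3 : ⁅q₃, p₀⁆ = -⁅p₀, q₃⁆ := (lie_skew _ _).symm
    rw [c₀', w₂, w₀'] at t
    simp only [lie_smul, smul_lie, lie_sub, sub_lie, lie_neg, z, c₁, t3] at t
    refine smul_right_injective L (show (8 : F) ≠ 0 by norm_num) ?_
    simp only
    linear_combination (norm := module) t
  -- With `[g, w] = 0`, `d₂` and `d₃` express `[q₁, q₂] - 4g` as the negative of the right side of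
  -- `f`, so twice this element vanishes.
  have t4 : ⁅q₁, p₂⁆ = -⁅p₂, q₁⁆ := (lie_skew _ _).symm
  rw [dz] at d₂ d₃
  rw [t4] at f
  apply half
  linear_combination (norm := module) (1 : F) • f + (1/2 : F) • d₂ + (1/2 : F) • d₃

end DolanGrady

/-! ### From a Dolan-Grady pair to Onsager's presentation -/

section DolanGrady

variable {F L : Type*} [Field F] [LieRing L] [LieAlgebra F L]

/-- Sequences `A`, `G` that satisfy the defining relations of the Onsager algebra in Onsager's
presentation. -/
structure IsOnsagerSeq (F : Type*) {L : Type*} [Field F] [LieRing L] [LieAlgebra F L]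
    (A G : ℤ → L) : Prop where
  odd : ∀ k, G (-k) = -G k
  lie_A_A : ∀ l m, ⁅A l, A m⁆ = (4 : F) • G (l - m)
  lie_G_A : ∀ k m, ⁅G k, A m⁆ = (2 : F) • (A (m + k) - A (m - k))

theorem exists_seq_of_initial [CharZero F] (g p q : L) :
    ∃ A : ℤ → L, A 0 = p ∧ A 1 = q ∧ ∀ m, ⁅g, A m⁆ = (2 : F) • (A (m + 1) - A (m - 1)) := by
  -- The second-order recursion as an invertible map on pairs of neighbours, so that integer powers
  -- run it in both directions.
  let e : Equiv.Perm (L × L) :=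
    { toFun := fun u => (u.2, u.1 + (1 / 2 : F) • ⁅g, u.2⁆)
      invFun := fun u => (u.2 - (1 / 2 : F) • ⁅g, u.1⁆, u.1)
      left_inv := fun u => by simp
      right_inv := fun u => by simp }
  have hsucc : ∀ m : ℤ, (e ^ (m + 1)) (p, q) = e ((e ^ m) (p, q)) := fun m => by
    rw [add_comm, zpow_add, zpow_one, Equiv.Perm.mul_apply]
  have hsnd : ∀ m : ℤ, ((e ^ (m + 1)) (p, q)).1 = ((e ^ m) (p, q)).2 := fun m => by
    rw [hsucc]; rfl
  refine ⟨fun m => ((e ^ m) (p, q)).1, by simp, ?_, fun m => ?_⟩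
  · simpa using hsnd 0
  · have h : ((e ^ (m + 1)) (p, q)).1 = ((e ^ (m - 1)) (p, q)).1
        + (1 / 2 : F) • ⁅g, ((e ^ m) (p, q)).1⁆ := by
      rw [hsnd, show m = m - 1 + 1 by ring, hsnd, hsucc]
      simp [e]
    simp only [h]
    module

theorem lie_succ_neg_step [CharZero F] {g : L} {A : ℤ → L}
    (hg : ∀ m, ⁅g, A m⁆ = (2 : F) • (A (m + 1) - A (m - 1)))
    (h₂ : ⁅A 2, A 1⁆ = (4 : F) • g) (h₁ : ⁅A 1, A 0⁆ = (4 : F) • g)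
    (h₀ : ⁅A 0, A (-1)⁆ = (4 : F) • g) : ⁅A (-1), A (-2)⁆ = (4 : F) • g := by
  have k₂ := hg 2
  have k₁ := hg 1
  have k₀ := hg 0
  have j₁ := hg (-1)
  have j₂ := hg (-2)
  norm_num at k₂ k₁ k₀ j₁ j₂
  exact lie_consecutive_step k₂ k₁ k₀ j₁ j₂ h₂ h₁ h₀

/-- A window of three consecutive brackets is moved one place at a time, in both directions. -/
theorem lie_succ [CharZero F] {g : L} {A : ℤ → L}
    (hg : ∀ m, ⁅g, A m⁆ = (2 : F) • (A (m + 1) - A (m - 1)))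
    (h₂ : ⁅A 2, A 1⁆ = (4 : F) • g) (h₁ : ⁅A 1, A 0⁆ = (4 : F) • g)
    (h₀ : ⁅A 0, A (-1)⁆ = (4 : F) • g) (m : ℤ) : ⁅A (m + 1), A m⁆ = (4 : F) • g := by
  suffices h : ∀ m : ℤ, ⁅A (m + 2), A (m + 1)⁆ = (4 : F) • g ∧ ⁅A (m + 1), A m⁆ = (4 : F) • g ∧
      ⁅A m, A (m - 1)⁆ = (4 : F) • g from (h m).2.1
  intro m
  induction m using Int.induction_on with
  | zero => simpa using ⟨h₂, h₁, h₀⟩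
  | succ n ih =>
    obtain ⟨i₂, i₁, i₀⟩ := ih
    -- The upward step is the downward one for the reflected sequence; reflection reverses the
    -- brackets, which the sign of `g` absorbs.
    have h := lie_succ_neg_step (F := F) (g := -g) (A := fun j => A (n + 1 - j)) (fun j => by
        rw [neg_lie, hg, show (n : ℤ) + 1 - j + 1 = n + 1 - (j - 1) by ring,
          show (n : ℤ) + 1 - j - 1 = n + 1 - (j + 1) by ring]
        module)
      (by
        rw [← lie_skew, show (n : ℤ) + 1 - 1 = n by ring, show (n : ℤ) + 1 - 2 = n - 1 by ring, i₀,
          smul_neg])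
      (by
        rw [← lie_skew, show (n : ℤ) + 1 - 1 = n by ring, sub_zero, i₁, smul_neg])
      (by
        rw [← lie_skew, show (n : ℤ) + 1 - -1 = n + 2 by ring, sub_zero, i₂, smul_neg])
    refine ⟨?_, ?_, ?_⟩
    · rw [← lie_skew, show (n : ℤ) + 1 - -1 = n + 1 + 1 by ring,
        show (n : ℤ) + 1 - -2 = n + 1 + 2 by ring, smul_neg, neg_inj] at h
      exact h
    · rw [show (n : ℤ) + 1 + 1 = n + 2 by ring, i₂]
    · rw [show (n : ℤ) + 1 - 1 = n by ring, i₁]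
  | pred n ih =>
    obtain ⟨i₂, i₁, i₀⟩ := ih
    have h := lie_succ_neg_step (F := F) (g := g) (A := fun j => A (-n + j)) (fun j => by
        rw [hg, add_assoc, add_sub_assoc]) i₂ (by simpa using i₁) (by rwa [add_zero])
    refine ⟨?_, ?_, ?_⟩
    · rw [show -(n : ℤ) - 1 + 2 = -n + 1 by ring, show -(n : ℤ) - 1 + 1 = -n by ring, i₁]
    · rw [show -(n : ℤ) - 1 + 1 = -n by ring, i₀]
    · rw [show -(n : ℤ) - 1 - 1 = -n + -2 by ring]
      exact h

/-- Strong induction on the distance `l - m`. The main point is that `[A l, A m]` depends only on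
this distance; the action of `G` then follows from the Jacobi identity. -/
theorem isOnsagerSeq_of_lie_succ [CharZero F] {g : L} {A : ℤ → L}
    (hg : ∀ m, ⁅g, A m⁆ = (2 : F) • (A (m + 1) - A (m - 1)))
    (h : ∀ m, ⁅A (m + 1), A m⁆ = (4 : F) • g) :
    IsOnsagerSeq F A fun k => (1 / 4 : F) • ⁅A k, A 0⁆ := by
  have four : (4 : F) ≠ 0 := by norm_num
  set G : ℤ → L := fun k => (1 / 4 : F) • ⁅A k, A 0⁆ with hG
  have hG4 : ∀ k, ⁅A k, A 0⁆ = (4 : F) • G k := fun k => by simp [hG, smul_smul, four]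
  have hG0 : G 0 = 0 := by simp [hG]
  have hG1 : G 1 = g := by simp [hG, show ⁅A 1, A 0⁆ = (4 : F) • g by simpa using h 0, smul_smul, four]
  have key : ∀ n : ℕ, ∀ j ≤ n, (∀ l m : ℤ, l - m = j → ⁅A l, A m⁆ = (4 : F) • G j) ∧
      ∀ m, ⁅G j, A m⁆ = (2 : F) • (A (m + j) - A (m - j)) := by
    intro n
    induction n with
    | zero =>
      intro j hj
      obtain rfl : j = 0 := by omega
      refine ⟨fun l m hlm => ?_, fun m => by simp [hG0]⟩
      obtain rfl : l = m := by simpa [sub_eq_zero] using hlm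
      simp [hG0]
    | succ n ih =>
      intro j hj
      rcases Nat.lt_or_ge j (n + 1) with hlt | hge
      · exact ih j (by omega)
      obtain rfl : j = n + 1 := by omega
      rcases n with _ | n
      · refine ⟨fun l m hlm => ?_, fun m => by simp [hG1, hg]⟩
        obtain rfl : l = m + 1 := by simp at hlm; omega
        simp [hG1, h]
      have c1 : ∀ l m : ℤ, l - m = (n + 1 : ℕ) → ⁅A l, A m⁆ = (4 : F) • G (n + 1 : ℕ) :=
        (ih (n + 1) le_rfl).1
      have t1 := (ih (n + 1) le_rfl).2
      have c0 := (ih n (by omega)).1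
      have t1' : ∀ m, ⁅A m, G (n + 1 : ℕ)⁆
          = -((2 : F) • (A (m + (n + 1 : ℕ)) - A (m - (n + 1 : ℕ)))) := fun m => by
        rw [← lie_skew, t1]
      have c : ∀ l m : ℤ, l - m = (n + 1 + 1 : ℕ) → ⁅A l, A m⁆ = (4 : F) • G (n + 1 + 1 : ℕ) := by
        set d := (2 : F) • ⁅g, G (n + 1 : ℕ)⁆ with hd
        let e : ℤ → L := fun m => ⁅A (m + (n + 1 : ℕ) + 1), A m⁆
        -- Apply `ad g` to the known bracket at distance `n + 1`; the two terms at distance `n`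
        -- cancel.
        have e1 : ∀ m, e (m - 1) = e m - d := fun m => by
          have t := leibniz_lie g (A (m + (n + 1 : ℕ))) (A m)
          rw [c1 _ m (by ring), hg, hg] at t
          simp only [lie_smul, smul_lie, lie_sub, sub_lie] at t
          rw [c0 (m + (n + 1 : ℕ) - 1) m (by push_cast; ring),
            c0 (m + (n + 1 : ℕ)) (m + 1) (by push_cast; ring)] at t
          simp only [e, hd]
          rw [show m - 1 + (n + 1 : ℕ) + 1 = m + (n + 1 : ℕ) by ring]
          linear_combination (norm := module) (1 / 2 : F) • t
        -- Apply `[A (m + 1), A m] = 4g` to `G (n + 1)` instead.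
        have e2 : ∀ m, e (m - (n + 1 : ℕ)) = e m + d := fun m => by
          have t := lie_lie (A (m + 1)) (A m) (G (n + 1 : ℕ))
          rw [h, t1', t1'] at t
          simp only [lie_smul, smul_lie, lie_sub, lie_neg] at t
          rw [← lie_skew (A (m + 1)) (A (m + (n + 1 : ℕ))),
            ← lie_skew (A m) (A (m + 1 + (n + 1 : ℕ))),
            c0 (m + (n + 1 : ℕ)) (m + 1) (by push_cast; ring),
            c0 m (m + 1 - (n + 1 : ℕ)) (by push_cast; ring)] at t
          simp only [e, hd]
          rw [show m - (n + 1 : ℕ) + (n + 1 : ℕ) + 1 = m + 1 by ring,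
            show m + (n + 1 : ℕ) + 1 = m + 1 + (n + 1 : ℕ) by ring]
          linear_combination (norm := module) (-1 / 2 : F) • t
        have e3 : ∀ (k : ℕ) (m : ℤ), e (m - k) = e m - (k : F) • d := by
          intro k
          induction k with
          | zero => simp
          | succ k ihk =>
            intro m
            rw [show m - (k + 1 : ℕ) = m - k - 1 by push_cast; ring, e1, ihk]
            push_cast
            module
        -- Moving down by `n + 1` adds `-(n + 1)d` in single steps and `d` in one jump, so `(n + 2)d
        -- = 0`.
        have d0 : d = 0 := by
          have t : ((n + 1 : ℕ) + 1 : F) • d = 0 := by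
            linear_combination (norm := module) e3 (n + 1) 0 - e2 0
          exact (smul_eq_zero.1 t).resolve_left (by exact Nat.cast_add_one_ne_zero (n + 1))
        have e4 : ∀ m, e m = e 0 := by
          intro m
          simp only [d0, sub_zero] at e1
          induction m using Int.induction_on with
          | zero => rfl
          | succ k ihk => rw [← ihk, ← e1, add_sub_cancel_right]
          | pred k ihk => rw [e1, ihk]
        intro l m hlm
        have := e4 m
        simp only [e] at this
        rw [show l = m + (n + 1 : ℕ) + 1 by push_cast at hlm ⊢; omega, this, ← hG4]
        congr 2
        push_cast
        ring
      refine ⟨c, fun m => ?_⟩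
      have t := leibniz_lie (A m) (A (m + 1)) (A (m + 1 - (n + 1 + 1 : ℕ)))
      rw [c (m + 1) (m + 1 - (n + 1 + 1 : ℕ)) (by ring), ← lie_skew (A m) (A (m + 1)), h,
        c1 m _ (by push_cast; ring)] at t
      simp only [lie_smul, smul_lie, neg_lie] at t
      rw [hg, t1', ← lie_skew] at t
      rw [show m + 1 - (n + 1 + 1 : ℕ) + 1 = m + 1 - (n + 1 : ℕ) by push_cast; ring,
        show m + 1 - (n + 1 + 1 : ℕ) - 1 = m - (n + 1 + 1 : ℕ) by push_cast; ring,
        show m + 1 + (n + 1 : ℕ) = m + (n + 1 + 1 : ℕ) by push_cast; ring] at t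
      linear_combination (norm := module) (-1 / 4 : F) • t
  have hodd : ∀ n : ℕ, G (-n) = -G n := fun n => by
    refine smul_right_injective L four ?_
    simp only
    rw [← hG4, ← lie_skew, (key n n le_rfl).1 0 (-n) (by simp), smul_neg]
  refine ⟨fun k => ?_, fun l m => ?_, fun k m => ?_⟩
  · obtain ⟨n, rfl | rfl⟩ := k.eq_nat_or_neg
    · exact hodd n
    · rw [neg_neg, hodd, neg_neg]
  · obtain ⟨n, hn | hn⟩ := (l - m).eq_nat_or_neg
    · rw [hn]
      exact (key n n le_rfl).1 l m hn
    · rw [hn, hodd, ← lie_skew, (key n n le_rfl).1 m l (by omega), smul_neg]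
  · obtain ⟨n, rfl | rfl⟩ := k.eq_nat_or_neg
    · exact (key n n le_rfl).2 m
    · rw [hodd, neg_lie, (key n n le_rfl).2 m, ← sub_eq_add_neg, sub_neg_eq_add]
      module

/-- A pair that satisfies the Dolan-Grady relations. -/
def IsDolanGradyPair (F : Type*) {L : Type*} [Field F] [LieRing L] [LieAlgebra F L]
    (a b : L) : Prop :=
  ⁅a, ⁅a, ⁅a, b⁆⁆⁆ = (4 : F) • ⁅a, b⁆ ∧ ⁅b, ⁅b, ⁅b, a⁆⁆⁆ = (4 : F) • ⁅b, a⁆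

/-- With `g = [b, a]` the bracket `[A 1, A 0] = 4g` is automatic, and the two Dolan-Grady relations
supply its neighbours on either side. -/
theorem IsDolanGradyPair.exists_isOnsagerSeq [CharZero F] {a b : L} (h : IsDolanGradyPair F a b) :
    ∃ A G : ℤ → L, IsOnsagerSeq F A G ∧ A 0 = (2 : F) • a ∧ A 1 = (2 : F) • b := by
  obtain ⟨A, hA0, hA1, hg⟩ := exists_seq_of_initial (F := F) ⁅b, a⁆ ((2 : F) • a) ((2 : F) • b)
  refine ⟨A, _, isOnsagerSeq_of_lie_succ hg (lie_succ hg ?_ ?_ ?_), hA0, hA1⟩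
  · have h2 : A 2 = A 0 + (1 / 2 : F) • ⁅⁅b, a⁆, A 1⁆ := by
      rw [hg 1]; norm_num; module
    rw [h2, hA0, hA1]
    have := h.2
    rw [← lie_skew b ⁅b, ⁅b, a⁆⁆, ← lie_skew b ⁅b, a⁆] at this
    simp only [lie_smul, smul_lie, add_lie, neg_lie, neg_neg] at this ⊢
    rw [this, ← lie_skew b a]
    module
  · rw [hA0, hA1]
    simp only [lie_smul, smul_lie]
    module
  · have h2 : A (-1) = A 1 - (1 / 2 : F) • ⁅⁅b, a⁆, A 0⁆ := by
      rw [hg 0]; norm_num; module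
    rw [h2, hA0, hA1]
    have := h.1
    rw [← lie_skew a b, lie_neg, lie_neg, ← lie_skew a ⁅b, a⁆] at this
    simp only [lie_smul, smul_lie, lie_sub, lie_neg, neg_neg] at this ⊢
    rw [this, ← lie_skew a b]
    module

end DolanGrady

/-! ### The recursion in an abstract Lie algebra -/

section Recursion

variable {F L : Type*} [Field F] [LieRing L] [LieAlgebra F L]

/-- The recursion for `[0312]`, with arbitrary elements `a`, `b` of a Lie algebra in place of the
standard generators. -/
def IsRecSolution (F : Type*) {L : Type*} [Field F] [LieRing L] [LieAlgebra F L] (a b : L)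
    (v : Idx → L) : Prop :=
  v (.A 0) = a ∧ v (.B 0) = b ∧ ∀ i : ℕ,
    v (.psi i) = (1 / 2 : F) • v (.A i) + (1 / 2 : F) • v (.B i) - (1 / 4 : F) • ⁅v (.A i), b⁆ ∧
    v (.A (i + 1)) = (1 / 2 : F) • ⁅v (.psi i), a⁆ - v (.psi i) ∧
    v (.B (i + 1)) = (1 / 2 : F) • ⁅b, v (.psi i)⁆ - v (.psi i)

theorem IsRecSolution.unique {a b : L} {v w : Idx → L} (hv : IsRecSolution F a b v)
    (hw : IsRecSolution F a b w) : v = w := by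
  have hAB : ∀ i, v (.A i) = w (.A i) ∧ v (.B i) = w (.B i) := by
    intro i
    induction i with
    | zero => exact ⟨hv.1.trans hw.1.symm, hv.2.1.trans hw.2.1.symm⟩
    | succ i ih =>
      have hψ : v (.psi i) = w (.psi i) := by rw [(hv.2.2 i).1, (hw.2.2 i).1, ih.1, ih.2]
      exact ⟨by rw [(hv.2.2 i).2.1, (hw.2.2 i).2.1, hψ], by
        rw [(hv.2.2 i).2.2, (hw.2.2 i).2.2, hψ]⟩
  funext j
  rcases j with i | i | i
  · exact (hAB i).1
  · exact (hAB i).2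
  · rw [(hv.2.2 i).1, (hw.2.2 i).1, (hAB i).1, (hAB i).2]

theorem IsRecSolution.map {L' : Type*} [LieRing L'] [LieAlgebra F L'] (φ : L →ₗ⁅F⁆ L') {a b : L}
    {v : Idx → L} (hv : IsRecSolution F a b v) : IsRecSolution F (φ a) (φ b) fun j => φ (v j) := by
  refine ⟨congrArg φ hv.1, congrArg φ hv.2.1, fun i => ⟨?_, ?_, ?_⟩⟩
  · simp only [(hv.2.2 i).1, map_add, map_sub, map_smul, LieHom.map_lie]
  · simp only [(hv.2.2 i).2.1, map_sub, map_smul, LieHom.map_lie]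
  · simp only [(hv.2.2 i).2.2, map_sub, map_smul, LieHom.map_lie]

/-- Multiplication by `-(T + T⁻¹ + 2) / 4`, where `T` is the shift, on sequences indexed by `ℤ`. -/
def shiftStep (F : Type*) {L : Type*} [Field F] [LieRing L] [LieAlgebra F L] (X : ℤ → L) : ℤ → L :=
  fun m => -((1 / 4 : F) • (X (m + 1) + X (m - 1))) - (1 / 2 : F) • X m

theorem shiftStep_odd {Y : ℤ → L} (h : ∀ k, Y (-k) = -Y k) (k : ℤ) :
    shiftStep F Y (-k) = -shiftStep F Y k := by
  simp only [shiftStep, show -k + 1 = -(k - 1) by ring, show -k - 1 = -(k + 1) by ring, h]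
  module

theorem lie_shiftStep_left {X Y A : ℤ → L} (h : ∀ l m, ⁅X l, A m⁆ = (4 : F) • Y (l - m))
    (l m : ℤ) : ⁅shiftStep F X l, A m⁆ = (4 : F) • shiftStep F Y (l - m) := by
  simp only [shiftStep, sub_lie, neg_lie, smul_lie, add_lie, h,
    show l + 1 - m = l - m + 1 by ring, show l - 1 - m = l - m - 1 by ring]
  module

/-- Together with the two preceding lemmas, this lets the operator play the role of multiplication
by `u` in a Lie algebra without such a module structure: it preserves the relations used. -/
theorem lie_shiftStep_right {X Y A : ℤ → L}
    (h : ∀ k m, ⁅Y k, A m⁆ = (2 : F) • (X (m + k) - X (m - k))) (k m : ℤ) :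
    ⁅shiftStep F Y k, A m⁆ = (2 : F) • (shiftStep F X (m + k) - shiftStep F X (m - k)) := by
  simp only [shiftStep, sub_lie, neg_lie, smul_lie, add_lie, h,
    show m + (k + 1) = m + k + 1 by ring, show m + (k - 1) = m + k - 1 by ring,
    show m - (k + 1) = m - k - 1 by ring, show m - (k - 1) = m - k + 1 by ring]
  module

theorem IsDolanGradyPair.exists_isRecSolution [CharZero F] {a b : L}
    (h : IsDolanGradyPair F a b) : ∃ v : Idx → L, IsRecSolution F a b v ∧
      ∀ i, ⁅v (.A i), a⁆ = 0 ∧ ⁅v (.B i), b⁆ = 0 ∧ ⁅v (.B i), a⁆ = -⁅v (.A i), b⁆ := by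
  obtain ⟨A, G, hAG, hA0, hA1⟩ := h.exists_isOnsagerSeq
  let X : ℕ → ℤ → L := fun i => (shiftStep F)^[i] A
  let Y : ℕ → ℤ → L := fun i => (shiftStep F)^[i] G
  have hXs : ∀ i, X (i + 1) = shiftStep F (X i) := fun i => Function.iterate_succ_apply' _ _ _
  have hYs : ∀ i, Y (i + 1) = shiftStep F (Y i) := fun i => Function.iterate_succ_apply' _ _ _
  have key : ∀ i, (∀ k, Y i (-k) = -Y i k) ∧ (∀ l m, ⁅X i l, A m⁆ = (4 : F) • Y i (l - m)) ∧
      ∀ k m, ⁅Y i k, A m⁆ = (2 : F) • (X i (m + k) - X i (m - k)) := by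
    intro i
    induction i with
    | zero => exact ⟨hAG.odd, hAG.lie_A_A, hAG.lie_G_A⟩
    | succ i ih =>
      rw [hXs, hYs]
      exact ⟨shiftStep_odd ih.1, lie_shiftStep_left ih.2.1, lie_shiftStep_right ih.2.2⟩
  have ha : a = (1 / 2 : F) • A 0 := by rw [hA0, smul_smul]; norm_num
  have hb : b = (1 / 2 : F) • A 1 := by rw [hA1, smul_smul]; norm_num
  have hY0 : ∀ i, Y i 0 = 0 := fun i => by
    have := (key i).1 0
    rw [neg_zero, eq_neg_iff_add_eq_zero, ← two_smul F] at this
    exact (smul_eq_zero.1 this).resolve_left two_ne_zero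
  have hXa : ∀ i l, ⁅X i l, a⁆ = (2 : F) • Y i l := fun i l => by
    rw [ha, lie_smul, (key i).2.1, sub_zero]; module
  have hXb : ∀ i l, ⁅X i l, b⁆ = (2 : F) • Y i (l - 1) := fun i l => by
    rw [hb, lie_smul, (key i).2.1]; module
  have hYa : ∀ i, ⁅Y i 1, a⁆ = X i 1 - X i (-1) := fun i => by
    rw [ha, lie_smul, (key i).2.2, zero_add, zero_sub]; module
  have hYb : ∀ i, ⁅Y i 1, b⁆ = X i 2 - X i 0 := fun i => by
    rw [hb, lie_smul, (key i).2.2, sub_self, one_add_one_eq_two]; module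
  have hYn : ∀ i, Y i (-1) = -Y i 1 := fun i => (key i).1 1
  -- The recursion forces `psi`, since `[(1/2) X i 0, b] = Y i (-1) = -Y i 1`.
  let v : Idx → L
    | .A i => (1 / 2 : F) • X i 0
    | .B i => (1 / 2 : F) • X i 1
    | .psi i => (1 / 4 : F) • (X i 0 + X i 1 + Y i 1)
  refine ⟨v, ⟨ha.symm, hb.symm, fun i => ⟨?_, ?_, ?_⟩⟩, fun i => ⟨?_, ?_, ?_⟩⟩
  · simp only [v, smul_lie, hXb, zero_sub, hYn]
    module
  · simp only [v, hXs, shiftStep, smul_lie, add_lie, hXa, hYa, zero_sub, zero_add, hY0]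
    module
  · rw [← lie_skew]
    simp only [v, hXs, shiftStep, smul_lie, add_lie, hXb, hYb, zero_sub, sub_self, hYn, hY0,
      one_add_one_eq_two]
    module
  · simp [v, hXa, hY0]
  · simp [v, hXb, hY0]
  · simp [v, hXa, hXb, hYn]

/-- The elements that bracket the span `S` into itself form a subalgebra `N`. It contains `a` and
`b`, so `S` is an ideal, hence a subalgebra containing the generators. -/
theorem IsRecSolution.span_eq_top [CharZero F] {a b : L} (h : IsDolanGradyPair F a b)
    (hgen : ∀ K : LieSubalgebra F L, a ∈ K → b ∈ K → K = ⊤) {v : Idx → L}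
    (hv : IsRecSolution F a b v) : Submodule.span F (Set.range v) = ⊤ := by
  obtain ⟨w, hw, hlie⟩ := h.exists_isRecSolution
  obtain rfl := hv.unique hw
  set S := Submodule.span F (Set.range v) with hS
  have hvS : ∀ j, v j ∈ S := fun j => Submodule.subset_span ⟨j, rfl⟩
  have hAb : ∀ i, ⁅v (.A i), b⁆ ∈ S := fun i => by
    have : ⁅v (.A i), b⁆ = (2 : F) • v (.A i) + (2 : F) • v (.B i) - (4 : F) • v (.psi i) := by
      rw [(hv.2.2 i).1]; module
    rw [this]
    exact S.sub_mem (S.add_mem (S.smul_mem _ (hvS _)) (S.smul_mem _ (hvS _)))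
      (S.smul_mem _ (hvS _))
  have hψa : ∀ i, ⁅v (.psi i), a⁆ ∈ S := fun i => by
    have : ⁅v (.psi i), a⁆ = (2 : F) • v (.A (i + 1)) + (2 : F) • v (.psi i) := by
      rw [(hv.2.2 i).2.1]; module
    rw [this]
    exact S.add_mem (S.smul_mem _ (hvS _)) (S.smul_mem _ (hvS _))
  have hbψ : ∀ i, ⁅b, v (.psi i)⁆ ∈ S := fun i => by
    have : ⁅b, v (.psi i)⁆ = (2 : F) • v (.B (i + 1)) + (2 : F) • v (.psi i) := by
      rw [(hv.2.2 i).2.2]; module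
    rw [this]
    exact S.add_mem (S.smul_mem _ (hvS _)) (S.smul_mem _ (hvS _))
  let N : LieSubalgebra F L :=
    { carrier := {u | ∀ s ∈ S, ⁅u, s⁆ ∈ S}
      add_mem' := fun hx hy s hs => by rw [add_lie]; exact S.add_mem (hx s hs) (hy s hs)
      zero_mem' := fun s _ => by rw [zero_lie]; exact S.zero_mem
      smul_mem' := fun c x hx s hs => by rw [smul_lie]; exact S.smul_mem c (hx s hs)
      lie_mem' := fun {x y} hx hy s hs => by
        rw [lie_lie]; exact S.sub_mem (hx _ (hy s hs)) (hy _ (hx s hs)) }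
  have hN : ∀ u : L, (∀ j, ⁅v j, u⁆ ∈ S) → u ∈ N := by
    intro u hu s hs
    have : S ≤ S.comap (LieAlgebra.ad F L u : L →ₗ[F] L) := by
      rw [hS, Submodule.span_le]
      rintro _ ⟨j, rfl⟩
      change ⁅u, v j⁆ ∈ S
      rw [← lie_skew]
      exact S.neg_mem (hu j)
    exact this hs
  have hNtop : N = ⊤ := by
    refine hgen N (hN a ?_) (hN b ?_)
    · rintro (i | i | i)
      · rw [(hlie i).1]; exact S.zero_mem
      · rw [(hlie i).2.2]; exact S.neg_mem (hAb i)
      · exact hψa i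
    · rintro (i | i | i)
      · exact hAb i
      · rw [(hlie i).2.1]; exact S.zero_mem
      · rw [← lie_skew]; exact S.neg_mem (hbψ i)
  let K : LieSubalgebra F L :=
    { S with
      lie_mem' := fun {x y} _ hy => by
        have hx : x ∈ N := by rw [hNtop]; exact LieSubalgebra.mem_top x
        exact hx y hy }
  have hK : K = ⊤ := hgen K (by rw [← hv.1]; exact hvS _) (by rw [← hv.2.1]; exact hvS _)
  rw [eq_top_iff]
  intro x _
  have : x ∈ K := by rw [hK]; exact LieSubalgebra.mem_top x
  exact this

end Recursion

/-! ### `O` is generated by a Dolan-Grady pair -/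

section Generation

variable (F : Type*) [Field F]

theorem lieSubalgebra_eq_top {K : LieSubalgebra F (O F)} (hA : genA F ∈ K) (hB : genB F ∈ K) :
    K = ⊤ := by
  let π : FreeLieAlgebra F Gen →ₗ⁅F⁆ O F :=
    { LieSubmodule.Quotient.mk' (dolanGradyIdeal F) with
      map_lie' := fun {_ _} => rfl }
  let φ : FreeLieAlgebra F Gen →ₗ⁅F⁆ K := FreeLieAlgebra.lift F fun
    | Gen.A => ⟨genA F, hA⟩
    | Gen.B => ⟨genB F, hB⟩
  have h : K.incl.comp φ = π := FreeLieAlgebra.hom_ext fun x => by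
    rw [LieHom.comp_apply, FreeLieAlgebra.lift_of_apply]
    cases x <;> rfl
  rw [eq_top_iff]
  rintro ⟨u⟩ -
  change π u ∈ K
  rw [← h]
  exact (φ u).2

theorem isDolanGradyPair_gen : IsDolanGradyPair F (genA F) (genB F) := by
  have h : ∀ w ∈ dolanGrady F, LieSubmodule.Quotient.mk' (dolanGradyIdeal F) w = 0 := fun w hw =>
    (LieSubmodule.Quotient.mk_eq_zero _).2 (LieSubmodule.subset_lieSpan hw)
  exact ⟨sub_eq_zero.1 (h _ (Or.inl rfl)), sub_eq_zero.1 (h _ (Or.inr rfl))⟩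

end Generation

/-! ### Solutions formed from powers of a scalar -/

section PowerFamily

variable {F R L : Type*} [Field F] [CommRing R] [LieRing L] [LieAlgebra R L] [LieAlgebra F L]

/-- The conditions under which the powers of `u` times `a`, `b`, `p` are a linearly independent
solution of the recursion for `a`, `b`. -/
structure IsPowerTriple (u : R) (a b p : L) : Prop where
  lie_a_b : ⁅a, b⁆ = (2 : R) • a + (2 : R) • b - (4 : R) • p
  lie_p_a : ⁅p, a⁆ = (2 : R) • u • a + (2 : R) • p
  lie_b_p : ⁅b, p⁆ = (2 : R) • u • b + (2 : R) • p
  coeff_eq_zero : ∀ α β γ : R, α • a + β • b + γ • p = 0 → α = 0 ∧ β = 0 ∧ γ = 0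

/-- The family `A_i = u ^ i a`, `B_i = u ^ i b`, `ψ_{i+1} = u ^ i p`. -/
def powerFamily (u : R) (a b p : L) : Idx → L
  | .A i => u ^ i • a
  | .B i => u ^ i • b
  | .psi i => u ^ i • p

theorem IsPowerTriple.isRecSolution [CharZero F] {u : R} {a b p : L} (h : IsPowerTriple u a b p) :
    IsRecSolution F a b (powerFamily u a b p) := by
  refine ⟨by simp [powerFamily], by simp [powerFamily], fun i => ⟨?_, ?_, ?_⟩⟩
  · have t : ⁅u ^ i • a, b⁆ = (2 : F) • u ^ i • a + (2 : F) • u ^ i • b - (4 : F) • u ^ i • p := by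
      rw [smul_lie, h.lie_a_b]
      simp only [ofNat_smul_eq_nsmul]
      module
    simp only [powerFamily, t]
    generalize u ^ i • a = a', u ^ i • b = b', u ^ i • p = p'
    module
  · have t : ⁅u ^ i • p, a⁆ = (2 : F) • u ^ (i + 1) • a + (2 : F) • u ^ i • p := by
      rw [smul_lie, h.lie_p_a]
      simp only [ofNat_smul_eq_nsmul]
      module
    simp only [powerFamily, t]
    generalize u ^ (i + 1) • a = a', u ^ i • p = p'
    module
  · have t : ⁅b, u ^ i • p⁆ = (2 : F) • u ^ (i + 1) • b + (2 : F) • u ^ i • p := by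
      rw [lie_smul, h.lie_b_p]
      simp only [ofNat_smul_eq_nsmul]
      module
    simp only [powerFamily, t]
    generalize u ^ (i + 1) • b = b', u ^ i • p = p'
    module

/-- Products of an `F`-independent family in `R` with an `R`-independent family in `L` are
`F`-independent. -/
theorem IsPowerTriple.linearIndependent [Algebra F R] [IsScalarTower F R L] {u : R} {a b p : L}
    (h : IsPowerTriple u a b p) (hu : LinearIndependent F fun i : ℕ => u ^ i) :
    LinearIndependent F (powerFamily u a b p) := by
  have h3 : LinearIndependent R ![a, b, p] := by
    rw [Fintype.linearIndependent_iff]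
    intro g hg i
    rw [Fin.sum_univ_three] at hg
    obtain ⟨h0, h1, h2⟩ := h.coeff_eq_zero _ _ _ hg
    fin_cases i <;> assumption
  let f : Idx → ℕ × Fin 3
    | .A i => (i, 0)
    | .B i => (i, 1)
    | .psi i => (i, 2)
  have hf : Function.Injective f := by
    rintro (i | i | i) (j | j | j) hij <;> simp_all [f]
  have hcomp : powerFamily u a b p = (fun q : ℕ × Fin 3 => u ^ q.1 • ![a, b, p] q.2) ∘ f := by
    funext j
    cases j <;> rfl
  rw [hcomp]
  exact (linearIndependent_smul hu h3).comp f hf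

end PowerFamily

/-! ### Four power triples from an equitable triple -/

section EquitableTriple

/-- A linearly independent triple with the bracket relations of the equitable basis of `sl₂`. -/
structure IsEquitableTriple (R : Type*) {L : Type*} [CommRing R] [LieRing L] [LieAlgebra R L]
    (X Y Z : L) : Prop where
  lie_X_Y : ⁅X, Y⁆ = (2 : R) • X + (2 : R) • Y
  lie_Y_Z : ⁅Y, Z⁆ = (2 : R) • Y + (2 : R) • Z
  lie_Z_X : ⁅Z, X⁆ = (2 : R) • Z + (2 : R) • X
  coeff_eq_zero : ∀ α β γ : R, α • X + β • Y + γ • Z = 0 → α = 0 ∧ β = 0 ∧ γ = 0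

namespace IsEquitableTriple

variable {R L : Type*} [CommRing R] [LieRing L] [LieAlgebra R L] {X Y Z : L}

theorem lie_Y_X (h : IsEquitableTriple R X Y Z) : ⁅Y, X⁆ = -((2 : R) • X + (2 : R) • Y) := by
  rw [← lie_skew, h.lie_X_Y]

theorem lie_Z_Y (h : IsEquitableTriple R X Y Z) : ⁅Z, Y⁆ = -((2 : R) • Y + (2 : R) • Z) := by
  rw [← lie_skew, h.lie_Y_Z]

theorem lie_X_Z (h : IsEquitableTriple R X Y Z) : ⁅X, Z⁆ = -((2 : R) • Z + (2 : R) • X) := by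
  rw [← lie_skew, h.lie_Z_X]

/-- Here and in the three variants, the signs of `a` and `b` fix `p` through `[a, b]`, and then `u`
through `[p, a]`. Independence holds because passing from `X, Y, Z` to `a, b, p` only involves the
units `s` and `s - 1`. -/
theorem isPowerTriple_0312 (h : IsEquitableTriple R X Y Z) {s : R} (hs : IsUnit s)
    (hs' : IsUnit (s - 1)) :
    IsPowerTriple (R := R) (s - 1) (X) (s • Y + (s - 1) • Z) ((s - 1) • Z) := by
  refine ⟨?_, ?_, ?_, fun α β γ e => ?_⟩
  iterate 3
    simp only [lie_add, add_lie, lie_smul, smul_lie, lie_self,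
      h.lie_X_Y, h.lie_Y_Z, h.lie_Z_X, h.lie_X_Z]
    module
  · obtain ⟨h1, h2, h3⟩ := h.coeff_eq_zero (α) (β * s)
      ((β + γ) * (s - 1)) (by rw [← e]; module)
    rw [hs.mul_left_eq_zero] at h2
    rw [hs'.mul_left_eq_zero, h2, zero_add] at h3
    exact ⟨h1, h2, h3⟩

theorem isPowerTriple_3021 (h : IsEquitableTriple R X Y Z) {s : R} (hs : IsUnit s)
    (hs' : IsUnit (s - 1)) :
    IsPowerTriple (R := R) (s - 1) (-X) (-(s • Y + (s - 1) • Z)) (-X - s • Y) := by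
  refine ⟨?_, ?_, ?_, fun α β γ e => ?_⟩
  iterate 3
    simp only [lie_add, add_lie, lie_sub, sub_lie, lie_smul, smul_lie, lie_neg, neg_lie, lie_self,
      h.lie_X_Y, h.lie_Z_X, h.lie_Y_X, h.lie_Z_Y, h.lie_X_Z]
    module
  · obtain ⟨h1, h2, h3⟩ := h.coeff_eq_zero (-α - γ) ((-β - γ) * s)
      (-β * (s - 1)) (by rw [← e]; module)
    rw [hs'.mul_left_eq_zero, neg_eq_zero] at h3
    rw [hs.mul_left_eq_zero, h3, neg_zero, zero_sub, neg_eq_zero] at h2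
    rw [h2, sub_zero, neg_eq_zero] at h1
    exact ⟨h1, h3, h2⟩

theorem isPowerTriple_0321 (h : IsEquitableTriple R X Y Z) {s : R} (hs : IsUnit s)
    (hs' : IsUnit (s - 1)) :
    IsPowerTriple (R := R) (-s) (-X) (s • Y + (s - 1) • Z) (s • Y) := by
  refine ⟨?_, ?_, ?_, fun α β γ e => ?_⟩
  iterate 3
    simp only [lie_add, add_lie, lie_smul, smul_lie, lie_neg, neg_lie, lie_self,
      h.lie_X_Y, h.lie_Y_X, h.lie_Z_Y, h.lie_X_Z]
    module
  · obtain ⟨h1, h2, h3⟩ := h.coeff_eq_zero (-α) ((β + γ) * s)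
      (β * (s - 1)) (by rw [← e]; module)
    rw [hs'.mul_left_eq_zero] at h3
    rw [hs.mul_left_eq_zero, h3, zero_add] at h2
    exact ⟨neg_eq_zero.1 h1, h3, h2⟩

theorem isPowerTriple_3012 (h : IsEquitableTriple R X Y Z) {s : R} (hs : IsUnit s)
    (hs' : IsUnit (s - 1)) :
    IsPowerTriple (R := R) (-s) (X) (-(s • Y + (s - 1) • Z)) (X - (s - 1) • Z) := by
  refine ⟨?_, ?_, ?_, fun α β γ e => ?_⟩
  iterate 3
    simp only [lie_add, add_lie, lie_sub, sub_lie, lie_smul, smul_lie, lie_neg, neg_lie, lie_self,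
      h.lie_X_Y, h.lie_Y_Z, h.lie_Z_X, h.lie_Y_X, h.lie_X_Z]
    module
  · obtain ⟨h1, h2, h3⟩ := h.coeff_eq_zero (α + γ) (-β * s)
      ((-β - γ) * (s - 1)) (by rw [← e]; module)
    rw [hs.mul_left_eq_zero, neg_eq_zero] at h2
    rw [hs'.mul_left_eq_zero, h2, neg_zero, zero_sub, neg_eq_zero] at h3
    rw [h3, add_zero] at h1
    exact ⟨h1, h2, h3⟩

end IsEquitableTriple

end EquitableTriple

/-! ### Units, powers and independence in the loop algebra -/

section Loop

variable (F : Type*) [Field F]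

theorem algebraMap_laurent_injective : Function.Injective (algebraMap F[X] (Laurent F)) := by
  have h : (Polynomial.X - 1 : F[X]) ≠ 0 := by simpa using Polynomial.X_sub_C_ne_zero (1 : F)
  exact IsLocalization.injective (M := Submonoid.powers (Polynomial.X * (Polynomial.X - 1))) _
    (powers_le_nonZeroDivisors_of_noZeroDivisors (mul_ne_zero Polynomial.X_ne_zero h))

theorem isUnit_tvar_mul : IsUnit (tvar F * (tvar F - 1)) := by
  have := IsLocalization.Away.algebraMap_isUnit (S := Laurent F)
    (Polynomial.X * (Polynomial.X - 1) : F[X])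
  simpa [tvar] using this

theorem isUnit_tvar : IsUnit (tvar F) := isUnit_of_mul_isUnit_left (isUnit_tvar_mul F)

theorem isUnit_tvar_sub_one : IsUnit (tvar F - 1) := isUnit_of_mul_isUnit_right (isUnit_tvar_mul F)

/-- A nonconstant polynomial is transcendental: composing a nonzero polynomial with it cannot give
zero. -/
theorem linearIndependent_pow_algebraMap {q : F[X]} (hq : q.natDegree ≠ 0) :
    LinearIndependent F fun i : ℕ => algebraMap F[X] (Laurent F) q ^ i := by
  have hinj : Function.Injective (Polynomial.aeval (R := F) (algebraMap F[X] (Laurent F) q)) := by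
    rw [injective_iff_map_eq_zero]
    intro p hp
    rw [Polynomial.aeval_algebraMap_apply, map_eq_zero_iff _ (algebraMap_laurent_injective F),
      ← Polynomial.comp_eq_aeval, Polynomial.comp_eq_zero_iff] at hp
    refine hp.resolve_right fun h => hq ?_
    rw [h.2, Polynomial.natDegree_C]
  have := (Polynomial.basisMonomials F).linearIndependent.map'
    (Polynomial.aeval (R := F) (algebraMap F[X] (Laurent F) q)).toLinearMap
    (LinearMap.ker_eq_bot.2 hinj)
  convert! this using 2 with i
  simp

theorem linearIndependent_tvar_sub_one_pow :
    LinearIndependent F fun i : ℕ => (tvar F - 1) ^ i := by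
  have := linearIndependent_pow_algebraMap F (q := Polynomial.X - Polynomial.C 1)
    (by rw [Polynomial.natDegree_X_sub_C]; exact one_ne_zero)
  simpa [tvar] using this

theorem linearIndependent_neg_tvar_pow : LinearIndependent F fun i : ℕ => (-tvar F) ^ i := by
  have := linearIndependent_pow_algebraMap F (q := -Polynomial.X)
    (by rw [Polynomial.natDegree_neg, Polynomial.natDegree_X]; exact one_ne_zero)
  simpa only [tvar, map_neg] using this

theorem linearIndependent_equitable [CharZero F] :
    LinearIndependent F ![eqX F, eqY F, eqZ F] := by
  rw [Fintype.linearIndependent_iff]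
  intro g hg
  rw [Fin.sum_univ_three] at hg
  have hg' := congrArg Subtype.val hg
  have h01 := congrFun (congrFun hg' 0) 1
  have h10 := congrFun (congrFun hg' 1) 0
  have h00 := congrFun (congrFun hg' 0) 0
  simp [eqX, eqY, eqZ, sl2E, sl2F, sl2H, Matrix.single] at h01 h10 h00
  simp [h01, h10] at h00
  intro i
  fin_cases i <;> assumption

/-- `u ⊗ 1`, with the factor `𝒜` written on the left. -/
noncomputable abbrev loopOf (u : Sl2 F) : Loop F := 1 ⊗ₜ[F] u

theorem tmul_eq_smul_loopOf (r : Laurent F) (u : Sl2 F) : (r ⊗ₜ[F] u : Loop F) = r • loopOf F u := by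
  simp [loopOf, TensorProduct.smul_tmul']

theorem isEquitableTriple_loop [CharZero F] :
    IsEquitableTriple (Laurent F) (loopOf F (eqX F)) (loopOf F (eqY F)) (loopOf F (eqZ F)) where
  lie_X_Y := by
    rw [LieAlgebra.ExtendScalars.bracket_tmul, lie_eqX_eqY, TensorProduct.tmul_add,
      TensorProduct.tmul_smul, TensorProduct.tmul_smul, one_mul]
    simp only [ofNat_smul_eq_nsmul]
  lie_Y_Z := by
    rw [LieAlgebra.ExtendScalars.bracket_tmul, lie_eqY_eqZ, TensorProduct.tmul_add,
      TensorProduct.tmul_smul, TensorProduct.tmul_smul, one_mul]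
    simp only [ofNat_smul_eq_nsmul]
  lie_Z_X := by
    rw [LieAlgebra.ExtendScalars.bracket_tmul, lie_eqZ_eqX, TensorProduct.tmul_add,
      TensorProduct.tmul_smul, TensorProduct.tmul_smul, one_mul]
    simp only [ofNat_smul_eq_nsmul]
  coeff_eq_zero α β γ h := by
    -- Independence over `F` becomes independence over the Laurent ring after base change.
    have hli := Module.Flat.linearIndependent_one_tmul (S := Laurent F)
      (linearIndependent_equitable F)
    rw [Fintype.linearIndependent_iff] at hli
    have := hli ![α, β, γ] (by simpa [Fin.sum_univ_three] using h)
    exact ⟨this 0, this 1, this 2⟩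

theorem loopB_eq : loopB F
    = tvar F • loopOf F (eqY F) + (tvar F - 1) • loopOf F (eqZ F) := by
  simp only [loopB, tmul_eq_smul_loopOf F (tvar F), tmul_eq_smul_loopOf F (tvar F - 1)]

end Loop

/-! ### Transfer between `O` and the loop algebra -/

section Bases

variable {F : Type*} [Field F] [CharZero F]

theorem exists_basis_of_powerFamily {a b : O F} (hdg : IsDolanGradyPair F a b)
    (hgen : ∀ K : LieSubalgebra F (O F), a ∈ K → b ∈ K → K = ⊤) {u : Laurent F} {p : Loop F}
    (hp : IsPowerTriple u (toLoop F a) (toLoop F b) p)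
    (hu : LinearIndependent F fun i : ℕ => u ^ i) :
    Function.Injective (toLoop F) ∧ ∃ e : Module.Basis Idx F (O F),
      (∀ j, toLoop F (e j) = powerFamily u (toLoop F a) (toLoop F b) p j) ∧
      IsRecSolution F a b e ∧ ∀ v, IsRecSolution F a b v → v = e := by
  obtain ⟨v, hv, -⟩ := hdg.exists_isRecSolution
  have hli := hp.linearIndependent hu
  -- Both sides solve the same recursion in the loop algebra, so no elementwise computation of the
  -- image is needed.
  have himg : (fun j => toLoop F (v j)) = powerFamily u (toLoop F a) (toLoop F b) p :=
    (hv.map (toLoop F)).unique hp.isRecSolution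
  have hliv : LinearIndependent F v := by
    refine LinearIndependent.of_comp (toLoop F : O F →ₗ[F] Loop F) ?_
    rw [← himg] at hli
    exact hli
  let e := Module.Basis.mk hliv (hv.span_eq_top hdg hgen).ge
  have he : ⇑e = v := Module.Basis.coe_mk _ _
  refine ⟨?_, e, fun j => ?_, ?_, fun w hw => ?_⟩
  -- A basis with linearly independent image: a kernel element has zero coordinates.
  · rw [injective_iff_map_eq_zero]
    intro x hx
    have hx' : Finsupp.linearCombination F (fun j => toLoop F (v j)) (e.repr x) = 0 := by
      have t := Finsupp.apply_linearCombination F (toLoop F : O F →ₗ[F] Loop F) e (e.repr x)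
      rw [e.linearCombination_repr, he] at t
      exact t.symm.trans hx
    rw [himg] at hx'
    exact e.repr.map_eq_zero_iff.1 (hli (hx'.trans (map_zero _).symm))
  · rw [he]
    exact congrFun himg j
  · rwa [he]
  · rw [he]
    exact hw.unique hv

end Bases

/-! ### Sign changes relating the four recursions -/

section Signs

variable {F L : Type*} [Field F] [LieRing L] [LieAlgebra F L]

theorem IsDolanGradyPair.neg_left {a b : L} (h : IsDolanGradyPair F a b) :
    IsDolanGradyPair F (-a) b := by
  refine ⟨?_, ?_⟩
  · simp only [neg_lie, lie_neg, neg_neg, smul_neg, h.1]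
  · simp only [lie_neg, smul_neg, h.2]

theorem IsDolanGradyPair.neg_right {a b : L} (h : IsDolanGradyPair F a b) :
    IsDolanGradyPair F a (-b) := by
  refine ⟨?_, ?_⟩
  · simp only [lie_neg, smul_neg, h.1]
  · simp only [neg_lie, lie_neg, neg_neg, smul_neg, h.2]

theorem rec3021_iff (v : Idx → O F) :
    Rec3021 F v ↔ IsRecSolution F (-genA F) (-genB F) v := by
  simp only [Rec3021, IsRecSolution, lie_neg, neg_lie, smul_neg, sub_neg_eq_add]

theorem rec0321_iff (v : Idx → O F) :
    Rec0321 F v ↔ IsRecSolution F (-genA F) (genB F) v := by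
  simp only [Rec0321, IsRecSolution, lie_neg, smul_neg]

theorem rec3012_iff (v : Idx → O F) :
    Rec3012 F v ↔ IsRecSolution F (genA F) (-genB F) v := by
  simp only [Rec3012, IsRecSolution, lie_neg, neg_lie, smul_neg, sub_neg_eq_add]

end Signs

/-! ### The four bases -/

section FourBases

variable (F : Type*) [Field F] [CharZero F]

theorem exists_basis_0312 : Function.Injective (toLoop F) ∧
    ∃ b : Module.Basis Idx F (O F),
      (∀ i, toLoop F (b (.A i)) = aUU F i) ∧ (∀ i, toLoop F (b (.B i)) = bUU F i) ∧
      (∀ i, toLoop F (b (.psi i)) = psiUU F i) ∧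
      Rec0312 F b ∧ ∀ v, Rec0312 F v → v = b := by
  obtain ⟨hinj, b, hb, hrec, huniq⟩ := exists_basis_of_powerFamily (a := genA F) (b := genB F)
    (u := tvar F - 1) (p := (tvar F - 1) • loopOf F (eqZ F)) (isDolanGradyPair_gen F)
    (fun K hA hB => lieSubalgebra_eq_top F hA hB)
    (by
      simp only [toLoop_genA, toLoop_genB, loopB_eq, loopA]
      exact (isEquitableTriple_loop F).isPowerTriple_0312 (isUnit_tvar F) (isUnit_tvar_sub_one F))
    (linearIndependent_tvar_sub_one_pow F)
  refine ⟨hinj, b, fun i => ?_, fun i => ?_, fun i => ?_, hrec, huniq⟩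
  · rw [hb, powerFamily, toLoop_genA, aUU, tmul_eq_smul_loopOf, loopA]
  · rw [hb, powerFamily, toLoop_genB, bUU, loopB]
  · rw [hb, powerFamily, psiUU, tmul_eq_smul_loopOf, smul_smul, pow_succ]

theorem exists_basis_3021 : ∃ b : Module.Basis Idx F (O F),
      (∀ i, toLoop F (b (.A i)) = aDD F i) ∧ (∀ i, toLoop F (b (.B i)) = bDD F i) ∧
      (∀ i, toLoop F (b (.psi i)) = psiDD F i) ∧
      Rec3021 F b ∧ ∀ v, Rec3021 F v → v = b := by
  obtain ⟨-, b, hb, hrec, huniq⟩ := exists_basis_of_powerFamily (a := -genA F) (b := -genB F)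
    (u := tvar F - 1) (p := -loopOf F (eqX F) - tvar F • loopOf F (eqY F))
    (isDolanGradyPair_gen F).neg_left.neg_right
    (fun K hA hB => lieSubalgebra_eq_top F (neg_mem_iff.1 hA) (neg_mem_iff.1 hB))
    (by
      simp only [map_neg, toLoop_genA, toLoop_genB, loopB_eq, loopA]
      exact (isEquitableTriple_loop F).isPowerTriple_3021 (isUnit_tvar F) (isUnit_tvar_sub_one F))
    (linearIndependent_tvar_sub_one_pow F)
  refine ⟨b, fun i => ?_, fun i => ?_, fun i => ?_, (rec3021_iff _).2 hrec,
    fun v hv => huniq v ((rec3021_iff _).1 hv)⟩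
  · rw [hb, powerFamily, map_neg, toLoop_genA, aDD, tmul_eq_smul_loopOf, loopA, smul_neg]
  · rw [hb, powerFamily, map_neg, toLoop_genB, bDD, loopB, neg_add']
  · rw [hb, powerFamily, psiDD, tmul_eq_smul_loopOf F (tvar F)]

theorem exists_basis_0321 : ∃ b : Module.Basis Idx F (O F),
      (∀ i, toLoop F (b (.A i)) = aDU F i) ∧ (∀ i, toLoop F (b (.B i)) = bDU F i) ∧
      (∀ i, toLoop F (b (.psi i)) = psiDU F i) ∧
      Rec0321 F b ∧ ∀ v, Rec0321 F v → v = b := by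
  obtain ⟨-, b, hb, hrec, huniq⟩ := exists_basis_of_powerFamily (a := -genA F) (b := genB F)
    (u := -tvar F) (p := tvar F • loopOf F (eqY F)) (isDolanGradyPair_gen F).neg_left
    (fun K hA hB => lieSubalgebra_eq_top F (neg_mem_iff.1 hA) hB)
    (by
      simp only [map_neg, toLoop_genA, toLoop_genB, loopB_eq, loopA]
      exact (isEquitableTriple_loop F).isPowerTriple_0321 (isUnit_tvar F) (isUnit_tvar_sub_one F))
    (linearIndependent_neg_tvar_pow F)
  refine ⟨b, fun i => ?_, fun i => ?_, fun i => ?_, (rec0321_iff _).2 hrec,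
    fun v hv => huniq v ((rec0321_iff _).1 hv)⟩
  · rw [hb, powerFamily, map_neg, toLoop_genA, aDU, tmul_eq_smul_loopOf, loopA, smul_neg]
  · rw [hb, powerFamily, toLoop_genB, bDU, loopB]
  -- The outer sign cancels one factor of the power: `-(-t)^(i+1) = (-t)^i t`, and the remaining `t`
  -- belongs to `p`.
  · rw [hb, powerFamily, psiDU, pow_succ, mul_neg, TensorProduct.neg_tmul, neg_neg,
      tmul_eq_smul_loopOf, mul_smul]

theorem exists_basis_3012 : ∃ b : Module.Basis Idx F (O F),
      (∀ i, toLoop F (b (.A i)) = aUD F i) ∧ (∀ i, toLoop F (b (.B i)) = bUD F i) ∧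
      (∀ i, toLoop F (b (.psi i)) = psiUD F i) ∧
      Rec3012 F b ∧ ∀ v, Rec3012 F v → v = b := by
  obtain ⟨-, b, hb, hrec, huniq⟩ := exists_basis_of_powerFamily (a := genA F) (b := -genB F)
    (u := -tvar F) (p := loopOf F (eqX F) - (tvar F - 1) • loopOf F (eqZ F))
    (isDolanGradyPair_gen F).neg_right
    (fun K hA hB => lieSubalgebra_eq_top F hA (neg_mem_iff.1 hB))
    (by
      simp only [map_neg, toLoop_genA, toLoop_genB, loopB_eq, loopA]
      exact (isEquitableTriple_loop F).isPowerTriple_3012 (isUnit_tvar F) (isUnit_tvar_sub_one F))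
    (linearIndependent_neg_tvar_pow F)
  refine ⟨b, fun i => ?_, fun i => ?_, fun i => ?_, (rec3012_iff _).2 hrec,
    fun v hv => huniq v ((rec3012_iff _).1 hv)⟩
  · rw [hb, powerFamily, toLoop_genA, aUD, tmul_eq_smul_loopOf, loopA]
  · rw [hb, powerFamily, map_neg, toLoop_genB, bUD, loopB, neg_add']
  · rw [hb, powerFamily, psiUD, tmul_eq_smul_loopOf F (tvar F - 1)]

end FourBases

end Onsager

theorem mainTheorem7 (F : Type*) [Field F] [CharZero F] :
    -- `O` embeds in the loop algebra by `A ↦ x ⊗ 1` and `B ↦ y ⊗ t + z ⊗ (t - 1)`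
    Function.Injective (Onsager.toLoop F) ∧
    -- `[0312]`
    (∃ b : Module.Basis Onsager.Idx F (Onsager.O F),
      (∀ i, Onsager.toLoop F (b (.A i)) = Onsager.aUU F i) ∧
      (∀ i, Onsager.toLoop F (b (.B i)) = Onsager.bUU F i) ∧
      (∀ i, Onsager.toLoop F (b (.psi i)) = Onsager.psiUU F i) ∧
      Onsager.Rec0312 F b ∧ ∀ v, Onsager.Rec0312 F v → v = b) ∧
    -- `[3021]`
    (∃ b : Module.Basis Onsager.Idx F (Onsager.O F),
      (∀ i, Onsager.toLoop F (b (.A i)) = Onsager.aDD F i) ∧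
      (∀ i, Onsager.toLoop F (b (.B i)) = Onsager.bDD F i) ∧
      (∀ i, Onsager.toLoop F (b (.psi i)) = Onsager.psiDD F i) ∧
      Onsager.Rec3021 F b ∧ ∀ v, Onsager.Rec3021 F v → v = b) ∧
    -- `[0321]`
    (∃ b : Module.Basis Onsager.Idx F (Onsager.O F),
      (∀ i, Onsager.toLoop F (b (.A i)) = Onsager.aDU F i) ∧
      (∀ i, Onsager.toLoop F (b (.B i)) = Onsager.bDU F i) ∧
      (∀ i, Onsager.toLoop F (b (.psi i)) = Onsager.psiDU F i) ∧
      Onsager.Rec0321 F b ∧ ∀ v, Onsager.Rec0321 F v → v = b) ∧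
    -- `[3012]`
    (∃ b : Module.Basis Onsager.Idx F (Onsager.O F),
      (∀ i, Onsager.toLoop F (b (.A i)) = Onsager.aUD F i) ∧
      (∀ i, Onsager.toLoop F (b (.B i)) = Onsager.bUD F i) ∧
      (∀ i, Onsager.toLoop F (b (.psi i)) = Onsager.psiUD F i) ∧
      Onsager.Rec3012 F b ∧ ∀ v, Onsager.Rec3012 F v → v = b) := by
  exact ⟨(Onsager.exists_basis_0312 F).1, (Onsager.exists_basis_0312 F).2,
    Onsager.exists_basis_3021 F, Onsager.exists_basis_0321 F, Onsager.exists_basis_3012 F⟩
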